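/- Fix real numbers $0<p_{\min}<p_{\max}$ and $B>0$, and let $\theta=p_{\max}/p_{\min}$. An instance of online linear programming with inventory management (OLIM) without rate constraints consists of a number of slots $T$ and, for each slot $t=1,\dots,T$, a price $p(t)\in[p_{\min},p_{\max}]$ and a demand $d(t)\ge 0$. A feasible solution consists of procurement amounts $x(t)\ge 0$ with $x(t)\ge d(t)-b(t-1)$ and $0\le b(t)\le B$ for all $t$, where the inventory level is given by $b(0)=0$ and $b(t)=b(t-1)+x(t)-d(t)$; its cost is $\sum_{t=1}^{T}p(t)x(t)$, and $\mathrm{cost}_\omega(\mathrm{OPT})$ is the minimum cost of a feasible solution of the instance $\omega$. A (deterministic) online algorithm chooses $x(t)$ as a function of $T$ and of $p(1),d(1),\dots,p(t),d(t)$. It is $c$-competitive with additive constant $K$ if on every instance $\omega$ (of every length $T$) its solution is feasible and has cost at most $c\cdot\mathrm{cost}_\omega(\mathrm{OPT})+K$; it is $c$-competitive if this holds for some constant $K\ge 0$ that does not depend on the instance. Let $$\alpha=\Bigl(W\Bigl(-\frac{\theta-1}{\theta e}\Bigr)+1\Bigr)^{-1},$$ where $W$ is the principal branch of the Lambert function,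 i.e. the inverse of $z\mapsto ze^z$ on $[-1,\infty)$. For $C>0$ let $$G_C(p)=\alpha C\ln\Bigl[\Bigl(1-\frac{p}{p_{\max}}\Bigr)\frac{\alpha}{\alpha-1}\Bigr]\quad\text{for } p\in[p_{\min},p_{\max}/\alpha],\qquad G_C(p)=0\quad\text{for } p>p_{\max}/\alpha .$$ BatMan is the following online algorithm. It keeps a list of $v$ storages, the $i$-th with a capacity $B_i$ and a reservation price $\xi_i$; initially $v=1$, $B_1=B$, $\xi_1=p_{\max}/\alpha$ and $b(0)=0$. In slot $t$: 1. if $d(t)>0$, it increases $v$ by one and sets $B_v=d(t)$, $\xi_v=p_{\max}/\alpha$; 2. it computes $x_i(t)=[G_{B_i}(p(t))-G_{B_i}(\xi_i)]^+$ and then replaces $\xi_i$ by $\min\{p(t),\xi_i\}$, for $1\le i\le v$; 3. it procures $x(t)=\max\bigl\{\sum_{i=1}^{v}x_i(t),\,[d(t)-b(t-1)]^+\bigr\}$ and sets $b(t)=b(t-1)+x(t)-d(t)$; 4. if $b(t)=0$, it resets $v=1$ and $\xi_1=p_{\max}/\alpha$. Theorem. BatMan is $\alpha$-competitive with additive constant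 $B\,p_{\max}$. Moreover, $\alpha$ is optimal: if some online algorithm is $c$-competitive, then $c\ge\alpha$. -/

import Mathlib

noncomputable section

namespace OLIM

/-! ### The problem without rate constraints

Slots are numbered `0, 1, …, T - 1`. Prices, demands and procurement amounts are sequences of which
only the entries with index `< T` matter. -/

/-- The prices lie in `[pmin, pmax]` and the demands are nonnegative on the horizon. -/
def IsInstance (pmin pmax : ℝ) (T : ℕ) (p d : ℕ → ℝ) : Prop :=
  ∀ t < T, p t ∈ Set.Icc pmin pmax ∧ 0 ≤ d t

/-- `level d x t` is the inventory level just before slot `t` (so after the first `t` slots), when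
the inventory is empty at the start. -/
def level (d x : ℕ → ℝ) : ℕ → ℝ
  | 0 => 0
  | t + 1 => level d x t + x t - d t

/-- Feasible procurement schedules for an inventory of capacity `B`. -/
structure Feasible (B : ℝ) (T : ℕ) (d x : ℕ → ℝ) : Prop where
  nonneg : ∀ t < T, 0 ≤ x t
  cover : ∀ t < T, d t - level d x t ≤ x t
  capacity : ∀ t < T, level d x (t + 1) ∈ Set.Icc 0 B

/-- The procurement cost of a schedule. -/
def cost (T : ℕ) (p x : ℕ → ℝ) : ℝ := ∑ t ∈ Finset.range T, p t * x t

/-- The offline optimal cost. On every instance the infimum is over a nonempty set (`x = d` is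
feasible) of nonnegative numbers. -/
def optCost (B : ℝ) (T : ℕ) (p d : ℕ → ℝ) : ℝ :=
  sInf {c : ℝ | ∃ x : ℕ → ℝ, Feasible B T d x ∧ c = cost T p x}

/-! ### Online algorithms and competitive ratio -/

/-- The list of the pairs (price, demand) of the slots `0, …, t`, in this order. -/
def history (p d : ℕ → ℝ) (t : ℕ) : List (ℝ × ℝ) :=
  (List.range (t + 1)).map fun s => (p s, d s)

/-- A deterministic online algorithm: the procurement amount in a slot is a function of the prices
and demands up to and including that slot. The algorithm may also use the number of slots (the
first argument). -/
abbrev OnlineAlgorithm : Type := ℕ → List (ℝ × ℝ) → ℝ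

/-- The schedule that an online algorithm produces. -/
def OnlineAlgorithm.run (A : OnlineAlgorithm) (T : ℕ) (p d : ℕ → ℝ) : ℕ → ℝ :=
  fun t => A T (history p d t)

/-- `A` produces a feasible schedule on every instance, of cost at most `c` times the offline
optimal cost plus `K`. -/
def CompetitiveWith (pmin pmax B : ℝ) (A : OnlineAlgorithm) (c K : ℝ) : Prop :=
  ∀ (T : ℕ) (p d : ℕ → ℝ), IsInstance pmin pmax T p d →
    Feasible B T d (A.run T p d) ∧ cost T p (A.run T p d) ≤ c * optCost B T p d + K

/-- `A` is `c`-competitive: there is an additive constant, the same for all instances. -/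
def Competitive (pmin pmax B : ℝ) (A : OnlineAlgorithm) (c : ℝ) : Prop :=
  ∃ K : ℝ, 0 ≤ K ∧ CompetitiveWith pmin pmax B A c K

/-! ### The competitive ratio `α` -/

/-- The (principal branch of the) Lambert function: the inverse of `z ↦ z * exp z` on `[-1, ∞)`. -/
def lambertW : ℝ → ℝ :=
  Function.invFunOn (fun z : ℝ => z * Real.exp z) (Set.Ici (-1))

/-- The ratio `α` as a function of the price fluctuation ratio `θ`. -/
def alpha (θ : ℝ) : ℝ := (lambertW (-((θ - 1) / (θ * Real.exp 1))) + 1)⁻¹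

/-! ### The algorithm BatMan -/

/-- The reservation function `G_C(p)` of a storage of capacity `C`; it vanishes for prices
above `pmax / α`. -/
def reservation (pmax α C p : ℝ) : ℝ :=
  if p ≤ pmax / α then α * C * Real.log ((1 - p / pmax) * (α / (α - 1))) else 0

/-- The state of BatMan after a slot. -/
structure BatManState where
  /-- The pairs (capacity `B_i`, reservation price `ξ_i`), the physical storage first. -/
  storages : List (ℝ × ℝ)
  /-- The inventory level. -/
  level : ℝ
  /-- The amount procured in the last slot. -/
  procured : ℝ

/-- The list of storages at the start and after each renewal: the physical storage only. -/
def initialStorages (pmax α B : ℝ) : List (ℝ × ℝ) := [(B, pmax / α)]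

/-- The initial state. -/
def batManInit (pmax α B : ℝ) : BatManState := ⟨initialStorages pmax α B, 0, 0⟩

/-- One slot of BatMan, on the pair `ω` of the current price and the current demand. -/
def batManStep (pmax α B : ℝ) (S : BatManState) (ω : ℝ × ℝ) : BatManState :=
  let p := ω.1
  let d := ω.2
  let storages := if 0 < d then S.storages ++ [(d, pmax / α)] else S.storages
  let preferred := (storages.map fun s =>
    max (reservation pmax α s.1 p - reservation pmax α s.1 s.2) 0).sum
  let x := max preferred (max (d - S.level) 0)
  let b := S.level + x - d
  { storages :=
      if b = 0 then initialStorages pmax α B else storages.map fun s => (s.1, min p s.2)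
    level := b
    procured := x }

/-- BatMan, with the parameter `α`, as an online algorithm. It does not use the horizon. -/
def batMan (pmax α B : ℝ) : OnlineAlgorithm :=
  fun _ h => (h.foldl (batManStep pmax α B) (batManInit pmax α B)).procured

end OLIM

end

noncomputable section

namespace OLIM

/-! ### The ratio `alpha` -/

/-! The defining equation of `α` amounts to `pmax * (1 - 1/α) * exp (1/α) = pmax - pmin`. It makes a
storage's reservation amount reach exactly its capacity at `pmin`, so BatMan never overfills the
inventory.

Upper bound: BatMan is compared slot by slot with an arbitrary feasible schedule, whose free space
`B - b` is valued at a price `q`. The inequality of `BatManInvariant` is kept for all `q ∈ [0,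
pmax/α]` at once: its instance at `q` after a slot of price `p` follows from the one at `min p q`
before it (`BatManInvariant.step`). The schedule's side needs only `min p q ≤ p` and `min p q ≤ q`;
BatMan's side is `mul_sub_le_reservation_sub`, a log inequality. At `q = pmax/α` the potential is
`pmax` times the missing inventory, which handles renewals and leaves the additive constant `B *
pmax`.

Lower bound: the gaps `pmax - price` grow geometrically from `pmax * (1 - 1/α)` to `pmax - pmin`.
The adversary may stop after any price, then ask for `B` units at price `pmax`. Being within a ratio
`a < α` at every stop forces purchases exceeding `B` (`sum_ge_of_savings`, `exists_grid`). Repeated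
rounds make the loss exceed any additive constant; measuring it by savings relative to `pmax`
accounts for inventory carried between rounds. -/

theorem lambertW_spec {y : ℝ} (h₁ : -Real.exp (-1) ≤ y) (h₂ : y ≤ 0) :
    -1 ≤ lambertW y ∧ lambertW y * Real.exp (lambertW y) = y := by
  have hc : ContinuousOn (fun z : ℝ => z * Real.exp z) (Set.Icc (-1) 0) := by fun_prop
  have hy : y ∈ (fun z : ℝ => z * Real.exp z) '' Set.Ici (-1) := by
    obtain ⟨z, hz, h⟩ := intermediate_value_Icc (by norm_num) hc
      (show y ∈ Set.Icc _ _ by simpa using ⟨h₁, h₂⟩)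
    exact ⟨z, hz.1, h⟩
  exact ⟨Function.invFunOn_mem hy, Function.invFunOn_eq hy⟩

/-- With `w = 1/α - 1`, this is `w * exp w = -(1 - 1/θ) / e` multiplied by `-e`. The only facts used
about `w` are this equation and `-1 < w < 0`. -/
theorem alpha_spec {θ : ℝ} (hθ : 1 < θ) :
    1 < alpha θ ∧ (1 - 1 / alpha θ) * Real.exp (1 / alpha θ) = 1 - 1 / θ := by
  have hy : -((θ - 1) / (θ * Real.exp 1)) = -((1 - 1 / θ) * Real.exp (-1)) := by
    rw [Real.exp_neg]; field_simp
  have h0 : 0 < 1 - 1 / θ := by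
    rw [sub_pos, div_lt_one (by linarith)]; exact hθ
  have h1 : 1 - 1 / θ < 1 := by
    have : 0 < 1 / θ := by positivity
    linarith
  have he := Real.exp_pos (-1)
  obtain ⟨hw, hwe⟩ := lambertW_spec (y := -((1 - 1 / θ) * Real.exp (-1)))
    (by nlinarith) (by nlinarith)
  unfold alpha
  rw [hy]
  set w := lambertW (-((1 - 1 / θ) * Real.exp (-1)))
  have hw0 : w < 0 := by
    by_contra! h
    nlinarith [mul_nonneg h (Real.exp_pos w).le]
  have hw1 : -1 < w := by
    refine lt_of_le_of_ne hw fun h => ?_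
    rw [← h] at hwe
    nlinarith
  refine ⟨(one_lt_inv₀ (by linarith)).2 (by linarith), ?_⟩
  rw [one_div (w + 1)⁻¹, inv_inv, Real.exp_add]
  have h2 : Real.exp (-1) * Real.exp 1 = 1 := by rw [← Real.exp_add]; simp
  linear_combination -Real.exp 1 * hwe + (1 - 1 / θ) * h2

/-! ### Levels and costs -/

theorem level_eq_sum (d x : ℕ → ℝ) (t : ℕ) :
    level d x t = ∑ s ∈ Finset.range t, (x s - d s) := by
  induction t with
  | zero => rfl
  | succ t ih => rw [Finset.sum_range_succ, ← ih, level]; ring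

theorem cost_succ (T : ℕ) (p x : ℕ → ℝ) : cost (T + 1) p x = cost T p x + p T * x T :=
  Finset.sum_range_succ _ _

theorem Feasible.level_mem {B : ℝ} {T : ℕ} {d x : ℕ → ℝ} (h : Feasible B T d x) (hB : 0 ≤ B)
    {t : ℕ} (ht : t ≤ T) : level d x t ∈ Set.Icc 0 B := by
  cases t with
  | zero => exact ⟨le_rfl, hB⟩
  | succ t => exact h.capacity t ht

theorem feasible_demand {pmin pmax B : ℝ} (hB : 0 ≤ B) {T : ℕ} {p d : ℕ → ℝ}
    (h : IsInstance pmin pmax T p d) : Feasible B T d d := by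
  have hl : ∀ t, level d d t = 0 := fun t => by simp [level_eq_sum]
  exact ⟨fun t ht => (h t ht).2, fun t _ => by simp [hl], fun t _ => by simp [hl, hB]⟩

theorem cost_nonneg {pmin pmax B : ℝ} (hpmin : 0 ≤ pmin) {T : ℕ} {p d x : ℕ → ℝ}
    (h : IsInstance pmin pmax T p d) (hx : Feasible B T d x) : 0 ≤ cost T p x :=
  Finset.sum_nonneg fun t ht => mul_nonneg (hpmin.trans (h t (Finset.mem_range.1 ht)).1.1)
    (hx.nonneg t (Finset.mem_range.1 ht))

theorem optCost_nonneg {pmin pmax B : ℝ} (hpmin : 0 ≤ pmin) {T : ℕ} {p d : ℕ → ℝ}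
    (h : IsInstance pmin pmax T p d) : 0 ≤ optCost B T p d := by
  refine Real.sInf_nonneg ?_
  rintro _ ⟨x, hx, rfl⟩
  exact cost_nonneg hpmin h hx

theorem optCost_le {pmin pmax B : ℝ} (hpmin : 0 ≤ pmin) {T : ℕ} {p d x : ℕ → ℝ}
    (h : IsInstance pmin pmax T p d) (hx : Feasible B T d x) : optCost B T p d ≤ cost T p x := by
  refine csInf_le ⟨0, ?_⟩ ⟨x, hx, rfl⟩
  rintro _ ⟨y, hy, rfl⟩
  exact cost_nonneg hpmin h hy

theorem le_optCost {pmin pmax B : ℝ} (hB : 0 ≤ B) {T : ℕ} {p d : ℕ → ℝ}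
    (h : IsInstance pmin pmax T p d) {a : ℝ} (ha : ∀ x, Feasible B T d x → a ≤ cost T p x) :
    a ≤ optCost B T p d := by
  refine le_csInf ⟨_, d, feasible_demand hB h, rfl⟩ ?_
  rintro _ ⟨x, hx, rfl⟩
  exact ha x hx

/-! ### The reservation function -/

section Reservation

variable {pmin pmax α C : ℝ}

theorem reservation_eq (hα : 1 < α) (hpmax : 0 < pmax) {p : ℝ} (hp : p ≤ pmax / α) :
    reservation pmax α C p = α * C * (Real.log (pmax - p) - Real.log (pmax - pmax / α)) := by
  have h : pmax / α < pmax := div_lt_self hpmax hα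
  rw [reservation, if_pos hp, ← Real.log_div (by linarith) (by linarith)]
  congr 2
  have : α - 1 ≠ 0 := by linarith
  field_simp

theorem reservation_cap (hα : 1 < α) (hpmax : 0 < pmax) :
    reservation pmax α C (pmax / α) = 0 := by
  rw [reservation_eq hα hpmax le_rfl, sub_self, mul_zero]

theorem reservation_anti (hα : 1 < α) (hpmax : 0 < pmax) (hC : 0 ≤ C) :
    Antitone (reservation pmax α C) := by
  have h : pmax / α < pmax := div_lt_self hpmax hα
  have key : ∀ p q, p ≤ q → q ≤ pmax / α → reservation pmax α C q ≤ reservation pmax α C p := by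
    intro p q hpq hq
    rw [reservation_eq hα hpmax hq, reservation_eq hα hpmax (hpq.trans hq)]
    have := Real.log_le_log (show 0 < pmax - q by linarith) (show pmax - q ≤ pmax - p by linarith)
    gcongr
  intro p q hpq
  by_cases hq : q ≤ pmax / α
  · exact key p q hpq hq
  · have hq' : reservation pmax α C q = 0 := if_neg hq
    by_cases hp : p ≤ pmax / α
    · rw [hq', ← reservation_cap (C := C) hα hpmax]
      exact key _ _ hp le_rfl
    · rw [hq', reservation, if_neg hp]

theorem le_pmax_div (hα : 1 < α) (hpmax : 0 < pmax)
    (hs : pmax * ((1 - 1 / α) * Real.exp (1 / α)) = pmax - pmin) : pmin ≤ pmax / α := by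
  have h1 : 0 < 1 - 1 / α := by
    rw [sub_pos, div_lt_one (by linarith)]; exact hα
  have h2 : 1 ≤ Real.exp (1 / α) := Real.one_le_exp (by positivity)
  have h3 : pmax - pmax / α = pmax * (1 - 1 / α) := by ring
  nlinarith [mul_pos hpmax h1]

/-- By monotonicity it suffices to look at `pmin`, where `hs` turns the logarithm into exactly
`1/α`. -/
theorem reservation_le_capacity (hα : 1 < α) (hpmax : 0 < pmax) (hC : 0 ≤ C)
    (hs : pmax * ((1 - 1 / α) * Real.exp (1 / α)) = pmax - pmin) {ξ : ℝ} (hξ : pmin ≤ ξ) :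
    reservation pmax α C ξ ≤ C := by
  have h1 : 0 < 1 - 1 / α := by
    rw [sub_pos, div_lt_one (by linarith)]; exact hα
  have hcap : pmax - pmax / α = pmax * (1 - 1 / α) := by ring
  have hle : pmin ≤ pmax / α := le_pmax_div hα hpmax hs
  refine (reservation_anti hα hpmax hC hξ).trans ?_
  rw [reservation_eq hα hpmax hle, hcap, ← hs, ← mul_assoc,
    Real.log_mul (by positivity) (by positivity), Real.log_exp, add_sub_cancel_left]
  apply le_of_eq
  field_simp

/-- Writes a preferred purchase as an increment of the reservation function between the old and new
`ξ`, so that purchases telescope. -/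
theorem max_reservation_sub (hα : 1 < α) (hpmax : 0 < pmax) (hC : 0 ≤ C) (p ξ : ℝ) :
    max (reservation pmax α C p - reservation pmax α C ξ) 0 =
      reservation pmax α C (min p ξ) - reservation pmax α C ξ := by
  have h := reservation_anti hα hpmax hC
  rcases le_total p ξ with hp | hp
  · rw [min_eq_left hp, max_eq_left (sub_nonneg.2 (h hp))]
  · rw [min_eq_right hp, max_eq_right (sub_nonpos.2 (h hp)), sub_self]

/-- Infinitesimally `(pmax - p) * |dG| = α * C * |dp|`; for a jump down to `p`, the factor `pmax -
p` dominates those at the prices passed over. This is `1 - 1/z ≤ log z`. -/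
theorem mul_sub_le_reservation_sub (hα : 1 < α) (hpmax : 0 < pmax) (hC : 0 ≤ C) (p : ℝ) {ξ : ℝ}
    (hξ : ξ ≤ pmax / α) :
    α * C * (ξ - min p ξ) ≤
      (pmax - p) * (reservation pmax α C (min p ξ) - reservation pmax α C ξ) := by
  rcases le_total ξ p with hp | hp
  · simp [min_eq_right hp]
  have hlt : pmax / α < pmax := div_lt_self hpmax hα
  have hξ' : 0 < pmax - ξ := by linarith
  have hp' : 0 < pmax - p := by linarith
  rw [min_eq_left hp, reservation_eq hα hpmax hξ, reservation_eq hα hpmax (hp.trans hξ)]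
  have hlog := Real.one_sub_inv_le_log_of_pos (div_pos hp' hξ')
  rw [Real.log_div hp'.ne' hξ'.ne', inv_div] at hlog
  have h1 : ξ - p ≤ (pmax - p) * (Real.log (pmax - p) - Real.log (pmax - ξ)) := by
    calc ξ - p = (pmax - p) * (1 - (pmax - ξ) / (pmax - p)) := by field_simp; ring
      _ ≤ _ := by gcongr
  calc α * C * (ξ - p) ≤ α * C * ((pmax - p) * (Real.log (pmax - p) - Real.log (pmax - ξ))) := by
        gcongr
    _ = _ := by ring

end Reservation

/-! ### BatMan is competitive -/

/-- The list of storages after the demand of the slot has been added. -/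
def withDemand (pmax α d : ℝ) (L : List (ℝ × ℝ)) : List (ℝ × ℝ) :=
  if 0 < d then L ++ [(d, pmax / α)] else L

/-- The condition on `f` lets a zero demand count as a storage of capacity zero, which removes the
case distinction. -/
theorem sum_withDemand {pmax α d : ℝ} (hd : 0 ≤ d) (L : List (ℝ × ℝ)) (f : ℝ × ℝ → ℝ)
    (hf : f (0, pmax / α) = 0) :
    ((withDemand pmax α d L).map f).sum = (L.map f).sum + f (d, pmax / α) := by
  unfold withDemand
  rcases hd.eq_or_lt with rfl | h
  · simp [hf]
  · simp [h]

theorem mem_withDemand {pmax α d : ℝ} {L : List (ℝ × ℝ)} {s : ℝ × ℝ}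
    (hs : s ∈ withDemand pmax α d L) : s ∈ L ∨ 0 < d ∧ s = (d, pmax / α) := by
  unfold withDemand at hs
  split_ifs at hs with h
  · simpa [h] using hs
  · exact Or.inl hs

/-- The term of a storage in the comparison of BatMan with a schedule that values its free
inventory at the price `q`. -/
def storagePotential (pmax α q : ℝ) (s : ℝ × ℝ) : ℝ :=
  pmax * (s.1 - reservation pmax α s.1 s.2) - α * s.1 * s.2 + α * s.1 * min s.2 q

/-- The invariant that relates a state of BatMan, which has paid `c` so far, to a feasible schedule
that has paid `c'` so far and has the inventory level `b`. -/
structure BatManInvariant (pmin pmax α B : ℝ) (S : BatManState) (c c' b : ℝ) : Prop where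
  storage : ∀ s ∈ S.storages, 0 ≤ s.1 ∧ s.2 ∈ Set.Icc pmin (pmax / α)
  level_nonneg : 0 ≤ S.level
  level_eq : S.level = B + (S.storages.map fun s => reservation pmax α s.1 s.2 - s.1).sum
  bound : ∀ q ∈ Set.Icc 0 (pmax / α),
    c + (S.storages.map (storagePotential pmax α q)).sum ≤ α * c' + α * q * (B - b)

section BatMan

variable {pmin pmax α B : ℝ}

theorem BatManInvariant.level_le {S : BatManState} {c c' b : ℝ}
    (h : BatManInvariant pmin pmax α B S c c' b) (hα : 1 < α) (hpmax : 0 < pmax)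
    (hs : pmax * ((1 - 1 / α) * Real.exp (1 / α)) = pmax - pmin) : S.level ≤ B := by
  have : (S.storages.map fun s => reservation pmax α s.1 s.2 - s.1).sum ≤
      (S.storages.map fun _ => (0 : ℝ)).sum :=
    List.sum_le_sum fun s hm => sub_nonpos.2 <|
      reservation_le_capacity hα hpmax (h.storage s hm).1 hs (h.storage s hm).2.1
  rw [h.level_eq]
  simpa using this

/-- At the cap every `min` equals the reservation price, and the two `α` terms cancel. -/
theorem sum_storagePotential_cap {L : List (ℝ × ℝ)} (hL : ∀ s ∈ L, s.2 ≤ pmax / α) :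
    (L.map (storagePotential pmax α (pmax / α))).sum =
      -pmax * (L.map fun s => reservation pmax α s.1 s.2 - s.1).sum := by
  rw [← List.sum_map_mul_left]
  congr 1
  refine List.map_congr_left fun s hm => ?_
  rw [storagePotential, min_eq_left (hL s hm)]
  ring

theorem BatManInvariant.cost_le {S : BatManState} {c c' b : ℝ}
    (h : BatManInvariant pmin pmax α B S c c' b) (hα : 1 < α) (hpmax : 0 < pmax) :
    c + pmax * (B - S.level) ≤ α * c' + pmax * (B - b) := by
  have hb := h.bound (pmax / α) ⟨by positivity, le_rfl⟩
  rw [sum_storagePotential_cap fun s hm => (h.storage s hm).2.2,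
    mul_div_cancel₀ _ (by positivity)] at hb
  rw [h.level_eq]
  linarith

/-- Serves both the start and every renewal; the bound on `c` is what the invariant at `q = pmax/α`
gives once BatMan's inventory is empty. -/
theorem batManInvariant_init {c c' b : ℝ} (hα : 1 < α) (hpmax : 0 < pmax) (hB : 0 ≤ B)
    (hcap : pmin ≤ pmax / α) (hb : 0 ≤ b) (hc : c ≤ α * c' - pmax * b) (x : ℝ) :
    BatManInvariant pmin pmax α B ⟨initialStorages pmax α B, 0, x⟩ c c' b := by
  refine ⟨?_, le_rfl, ?_, ?_⟩
  · simp [initialStorages, hB, hcap]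
  · simp [initialStorages, reservation_cap hα hpmax]
  · rintro q ⟨_, hq⟩
    have h1 : α * (pmax / α) = pmax := mul_div_cancel₀ _ (by positivity)
    have h2 : α * q ≤ pmax := h1 ▸ mul_le_mul_of_nonneg_left hq (by positivity)
    simp only [initialStorages, List.map_cons, List.map_nil, List.sum_cons, List.sum_nil,
      storagePotential, reservation_cap hα hpmax, min_eq_right hq]
    nlinarith [mul_le_mul_of_nonneg_right h2 hb]

theorem batManStep_procured (S : BatManState) (p d : ℝ) :
    (batManStep pmax α B S (p, d)).procured =
      max ((withDemand pmax α d S.storages).map fun s =>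
        max (reservation pmax α s.1 p - reservation pmax α s.1 s.2) 0).sum
        (max (d - S.level) 0) := rfl

theorem batManStep_level (S : BatManState) (p d : ℝ) :
    (batManStep pmax α B S (p, d)).level =
      S.level + (batManStep pmax α B S (p, d)).procured - d := rfl

theorem batManStep_storages (S : BatManState) (p d : ℝ) :
    (batManStep pmax α B S (p, d)).storages =
      if (batManStep pmax α B S (p, d)).level = 0 then initialStorages pmax α B
      else (withDemand pmax α d S.storages).map fun s => (s.1, min p s.2) := rfl

theorem BatManInvariant.step {S : BatManState} {c c' b p d x : ℝ}
    (h : BatManInvariant pmin pmax α B S c c' b) (hpmin : 0 < pmin) (hα : 1 < α) (hB : 0 ≤ B)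
    (hcap : pmin ≤ pmax / α) (hp : p ∈ Set.Icc pmin pmax) (hd : 0 ≤ d) (hx : 0 ≤ x)
    (hb : b + x - d ∈ Set.Icc 0 B) :
    BatManInvariant pmin pmax α B (batManStep pmax α B S (p, d))
      (c + p * (batManStep pmax α B S (p, d)).procured) (c' + p * x) (b + x - d) := by
  have hpmax : 0 < pmax := hpmin.trans_le (hp.1.trans hp.2)
  have hαcap : α * (pmax / α) = pmax := mul_div_cancel₀ _ (by positivity)
  have hst := batManStep_storages (pmax := pmax) (α := α) (B := B) S p d
  have hlev := batManStep_level (pmax := pmax) (α := α) (B := B) S p d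
  have hpro := batManStep_procured (pmax := pmax) (α := α) (B := B) S p d
  set S' := batManStep pmax α B S (p, d)
  set L := withDemand pmax α d S.storages with hL
  set L' := L.map fun s => (s.1, min p s.2) with hL'
  have hLs : ∀ s ∈ L, 0 ≤ s.1 ∧ s.2 ∈ Set.Icc pmin (pmax / α) := fun s hm => by
    rcases mem_withDemand hm with hm | ⟨_, rfl⟩
    · exact h.storage s hm
    · exact ⟨hd, hcap, le_rfl⟩
  have hL's : ∀ s ∈ L', 0 ≤ s.1 ∧ s.2 ∈ Set.Icc pmin (pmax / α) := fun s hm => by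
    obtain ⟨r, hr, rfl⟩ := List.mem_map.1 hm
    obtain ⟨h1, h2, h3⟩ := hLs r hr
    exact ⟨h1, le_min hp.1 h2, (min_le_right _ _).trans h3⟩
  -- `y` is the preferred amount. The invariant is first advanced as if exactly `y` were bought.
  obtain ⟨y, hy⟩ : ∃ y, y = (L.map fun s =>
    max (reservation pmax α s.1 p - reservation pmax α s.1 s.2) 0).sum := ⟨_, rfl⟩
  have hyeq : y = (L.map fun s =>
      reservation pmax α s.1 (min p s.2) - reservation pmax α s.1 s.2).sum := by
    rw [hy]
    congr 1
    exact List.map_congr_left fun s hm => max_reservation_sub hα hpmax (hLs s hm).1 _ _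
  have hy0 : 0 ≤ y := by
    rw [hy]
    refine List.sum_nonneg fun z hz => ?_
    obtain ⟨s, _, rfl⟩ := List.mem_map.1 hz
    exact le_max_right _ _
  rw [← hy] at hpro
  have hlevel' : B + (L'.map fun s => reservation pmax α s.1 s.2 - s.1).sum = S.level + y - d := by
    have h1 : (L'.map fun s => reservation pmax α s.1 s.2 - s.1).sum =
        (L.map fun s => reservation pmax α s.1 s.2 - s.1).sum + y := by
      rw [hyeq, hL', List.map_map, ← List.sum_map_add]
      congr 1
      exact List.map_congr_left fun s _ => by simp
    rw [h1, hL, sum_withDemand hd _ _ (by simp [reservation_cap hα hpmax]), h.level_eq,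
      reservation_cap hα hpmax]
    ring
  have hbound : ∀ q ∈ Set.Icc 0 (pmax / α),
      c + p * y + (L'.map (storagePotential pmax α q)).sum ≤
        α * (c' + p * x) + α * q * (B - (b + x - d)) := by
    rintro q ⟨hq0, hq⟩
    have h1 : (L.map fun s => p * (reservation pmax α s.1 (min p s.2) -
          reservation pmax α s.1 s.2) + storagePotential pmax α q (s.1, min p s.2)).sum ≤
        (L.map (storagePotential pmax α (min p q))).sum := by
      refine List.sum_le_sum fun s hm => ?_
      have := mul_sub_le_reservation_sub hα hpmax (hLs s hm).1 p (hLs s hm).2.2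
      have hmin : min (min p s.2) q = min s.2 (min p q) := by
        rw [min_comm p, min_assoc]
      simp only [storagePotential, hmin]
      linarith
    rw [List.sum_map_add, List.sum_map_mul_left, ← hyeq] at h1
    have h2 : (L.map (storagePotential pmax α (min p q))).sum =
        (S.storages.map (storagePotential pmax α (min p q))).sum + α * d * min p q := by
      rw [hL, sum_withDemand hd _ _ (by simp [storagePotential, reservation_cap hα hpmax])]
      congr 1
      rw [storagePotential, reservation_cap hα hpmax,
        min_eq_right ((min_le_right p q).trans hq)]
      linear_combination -d * hαcap
    have h3 := h.bound (min p q) ⟨le_min (hpmin.le.trans hp.1) hq0, (min_le_right _ _).trans hq⟩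
    have h4 : (L'.map (storagePotential pmax α q)).sum =
        (L.map fun s => storagePotential pmax α q (s.1, min p s.2)).sum := by
      rw [hL', List.map_map]; rfl
    have h5 : α * (min p q * x) ≤ α * (p * x) := by gcongr; exact min_le_left _ _
    have h6 : α * (min p q * (B - (b + x - d))) ≤ α * (q * (B - (b + x - d))) := by
      have : 0 ≤ B - (b + x - d) := sub_nonneg.2 hb.2
      gcongr; exact min_le_right _ _
    rw [h4]
    linarith
  have hlev0 : 0 ≤ S'.level := by
    have h1 : d - S.level ≤ S'.procured := by
      rw [hpro]; exact (le_max_left _ _).trans (le_max_right _ _)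
    linarith
  have hye : y ≤ S'.procured := hpro ▸ le_max_left _ _
  -- At a renewal the forced excess over `y` costs at most `pmax` per unit, the value the potential
  -- at the cap gives to missing inventory. Otherwise there is no excess, since a forced purchase
  -- empties the inventory.
  by_cases hz : S'.level = 0
  · rw [if_pos hz] at hst
    have hS' : S' = ⟨initialStorages pmax α B, 0, S'.procured⟩ := by
      rw [← hst, ← hz]
    rw [hS']
    refine batManInvariant_init hα hpmax hB hcap hb.1 ?_ _
    have h1 := hbound (pmax / α) ⟨by positivity, le_rfl⟩
    rw [sum_storagePotential_cap fun s hm => (hL's s hm).2.2, hαcap] at h1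
    have h2 : (L'.map fun s => reservation pmax α s.1 s.2 - s.1).sum = y - S'.procured - B := by
      linarith
    rw [h2] at h1
    nlinarith [mul_le_mul_of_nonneg_right hp.2 (sub_nonneg.2 hye)]
  · have hxy : S'.procured = y := by
      rw [hpro]
      refine max_eq_left (le_of_not_gt fun hlt => hz ?_)
      have h1 : 0 < d - S.level := by
        rcases lt_max_iff.1 (hy0.trans_lt hlt) with h1 | h1
        · exact h1
        · exact absurd h1 (lt_irrefl _)
      rw [hlev, hpro, max_eq_right hlt.le, max_eq_left h1.le]
      ring
    rw [if_neg hz] at hst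
    refine ⟨?_, hlev0, ?_, ?_⟩
    · rwa [hst]
    · rw [hst, hlevel', hlev, hxy]
    · rwa [hst, hxy]

/-- The state of BatMan before slot `t`. -/
def batManState (pmax α B : ℝ) (p d : ℕ → ℝ) (t : ℕ) : BatManState :=
  ((List.range t).map fun s => (p s, d s)).foldl (batManStep pmax α B) (batManInit pmax α B)

theorem batManState_succ (p d : ℕ → ℝ) (t : ℕ) :
    batManState pmax α B p d (t + 1) =
      batManStep pmax α B (batManState pmax α B p d t) (p t, d t) := by
  simp [batManState, List.range_succ]

theorem run_batMan (T : ℕ) (p d : ℕ → ℝ) (t : ℕ) :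
    (batMan pmax α B).run T p d t = (batManState pmax α B p d (t + 1)).procured := rfl

theorem level_run_batMan (T : ℕ) (p d : ℕ → ℝ) (t : ℕ) :
    level d ((batMan pmax α B).run T p d) t = (batManState pmax α B p d t).level := by
  induction t with
  | zero => rfl
  | succ t ih => rw [level, ih, run_batMan, batManState_succ, batManStep_level]

theorem batManInvariant_run (hpmin : 0 < pmin) (hα : 1 < α) (hpmax : 0 < pmax) (hB : 0 ≤ B)
    (hcap : pmin ≤ pmax / α) {T : ℕ} {p d x : ℕ → ℝ} (h : IsInstance pmin pmax T p d)
    (hx : Feasible B T d x) {t : ℕ} (ht : t ≤ T) :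
    BatManInvariant pmin pmax α B (batManState pmax α B p d t)
      (cost t p ((batMan pmax α B).run T p d)) (cost t p x) (level d x t) := by
  induction t with
  | zero => exact batManInvariant_init hα hpmax hB hcap le_rfl (by simp [cost]) _
  | succ t ih =>
    rw [cost_succ, cost_succ, run_batMan, batManState_succ]
    exact (ih (by omega)).step hpmin hα hB hcap (h t ht).1 (h t ht).2 (hx.nonneg t ht)
      (hx.capacity t ht)

theorem batMan_competitiveWith (hpmin : 0 < pmin) (hα : 1 < α) (hpmax : 0 < pmax) (hB : 0 ≤ B)
    (hcap : pmin ≤ pmax / α) (hs : pmax * ((1 - 1 / α) * Real.exp (1 / α)) = pmax - pmin) :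
    CompetitiveWith pmin pmax B (batMan pmax α B) α (B * pmax) := by
  intro T p d h
  -- The level bounds do not depend on the comparison schedule, so any feasible one serves for
  -- feasibility.
  have hI := fun t (ht : t ≤ T) =>
    batManInvariant_run hpmin hα hpmax hB hcap h (feasible_demand hB h) ht
  have hprocured : ∀ t, (batMan pmax α B).run T p d t =
      max _ (max (d t - (batManState pmax α B p d t).level) 0) := fun t => by
    rw [run_batMan, batManState_succ, batManStep_procured]
  refine ⟨⟨fun t _ => ?_, fun t _ => ?_, fun t ht => ?_⟩, ?_⟩
  · rw [hprocured]
    exact (le_max_right _ _).trans (le_max_right _ _)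
  · rw [level_run_batMan, hprocured]
    exact (le_max_left _ _).trans (le_max_right _ _)
  · rw [level_run_batMan]
    exact ⟨(hI _ ht).level_nonneg, (hI _ ht).level_le hα hpmax hs⟩
  · have hα0 : 0 < α := by linarith
    have key : (cost T p ((batMan pmax α B).run T p d) - B * pmax) / α ≤ optCost B T p d := by
      refine le_optCost hB h fun x hx => ?_
      rw [div_le_iff₀' hα0]
      have hI' := batManInvariant_run hpmin hα hpmax hB hcap h hx le_rfl
      have h1 := hI'.cost_le hα hpmax
      have h2 := mul_le_mul_of_nonneg_left (hI'.level_le hα hpmax hs) hpmax.le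
      have h3 := mul_nonneg hpmax.le (hx.level_mem hB le_rfl).1
      linarith
    rw [div_le_iff₀' hα0] at key
    linarith

end BatMan

/-! ### Optimality of the ratio -/

/-- Against prices that decrease from `q₀ = pmax - pmax / α` below `pmax` geometrically, purchases
whose total savings always stay above the requirement of the ratio `a` exceed the capacity. -/
theorem sum_ge_of_savings {pmax a B r : ℝ} {q δ : ℕ → ℝ} (hr : 1 < r) (hq0 : ∀ i, 0 < q i)
    (hq : ∀ i, q (i + 1) = r * q i) {n : ℕ}
    (h : ∀ j ≤ n, B * (pmax - a * (pmax - q j)) ≤ ∑ i ∈ Finset.range (j + 1), q i * δ i) :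
    B * ((pmax - a * (pmax - q 0)) / q 0 + n * (a * (1 - 1 / r))) ≤
      ∑ i ∈ Finset.range (n + 1), δ i := by
  have hr0 : 0 < r := by linarith
  -- Abel summation: passing from `j` to `j + 1`, the right side changes by the savings so far times
  -- `1 / q j - 1 / q (j + 1) ≥ 0`, so `h` bounds the change below. No sign of `δ` is needed.
  have key : ∀ j ≤ n, B * ((pmax - a * (pmax - q 0)) / q 0 + j * (a * (1 - 1 / r)) -
      (pmax - a * (pmax - q j)) / q j) ≤ ∑ i ∈ Finset.range (j + 1), δ i -
        (∑ i ∈ Finset.range (j + 1), q i * δ i) / q j := by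
    intro j hj
    induction j with
    | zero => simp [(hq0 0).ne']
    | succ j ih =>
      have h1 := ih (by omega)
      have h2 := h j (by omega)
      rw [Finset.sum_range_succ, Finset.sum_range_succ _ (j + 1)]
      set A := ∑ i ∈ Finset.range (j + 1), q i * δ i
      set V := ∑ i ∈ Finset.range (j + 1), δ i
      have hqj := hq0 j
      have h3 : 0 ≤ 1 / q j - 1 / q (j + 1) := by
        have : q j ≤ q (j + 1) := by rw [hq]; nlinarith
        exact sub_nonneg.2 (one_div_le_one_div_of_le hqj this)
      have h4 := mul_le_mul_of_nonneg_right h2 h3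
      have e1 : (A + q (j + 1) * δ (j + 1)) / q (j + 1) =
          A / q j - A * (1 / q j - 1 / q (j + 1)) + δ (j + 1) := by
        have := hq0 (j + 1)
        field_simp
        ring
      have e2 : (pmax - a * (pmax - q (j + 1))) / q (j + 1) = (pmax - a * (pmax - q j)) / q j -
          (pmax - a * (pmax - q j)) * (1 / q j - 1 / q (j + 1)) + a * (1 - 1 / r) := by
        rw [hq]
        field_simp
        ring
      rw [e1, e2]
      push_cast
      linarith
  have h1 := key n le_rfl
  have h2 := div_le_div_of_nonneg_right (h n le_rfl) (hq0 n).le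
  rw [mul_div_assoc] at h2
  linarith

/-- For a ratio `a < α`, a sufficiently fine geometric price grid forces savings to fail. -/
theorem exists_grid {α a : ℝ} (hα : 1 < α) (ha : 0 < a) (haα : a < α) :
    ∃ n : ℕ, 0 < n ∧
      1 < (α - a) / (α - 1) + n * (a * (1 - 1 / Real.exp (1 / (α * n)))) := by
  have hα1 : 0 < α - 1 := by linarith
  have hα0 : 0 < α := by linarith
  obtain ⟨n, hn⟩ := exists_nat_gt (a / (α - a))
  have hn0 : (0 : ℝ) < n := lt_of_le_of_lt (by have := sub_pos.2 haα; positivity) hn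
  refine ⟨n, by exact_mod_cast hn0, ?_⟩
  have h1 : 1 / Real.exp (1 / (α * n)) ≤ 1 / (1 / (α * n) + 1) :=
    one_div_le_one_div_of_le (by positivity) (Real.add_one_le_exp _)
  have h2 : (n : ℝ) * (a * (1 - 1 / (1 / (α * n) + 1))) ≤
      n * (a * (1 - 1 / Real.exp (1 / (α * n)))) := by gcongr
  refine lt_of_lt_of_le ?_ (add_le_add_right h2 _)
  have h3 : (n : ℝ) * (a * (1 - 1 / (1 / (α * n) + 1))) = a * n / (1 + α * n) := by
    field_simp
    ring
  rw [h3, div_add_div _ _ hα1.ne' (by positivity), lt_div_iff₀ (by positivity)]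
  rw [div_lt_iff₀ (sub_pos.2 haα)] at hn
  nlinarith

/-! ### Concatenation of instances and the rounds of the adversary -/

theorem run_congr (A : OnlineAlgorithm) (T : ℕ) {p d p' d' : ℕ → ℝ} {t : ℕ}
    (h : ∀ s ≤ t, p s = p' s ∧ d s = d' s) : A.run T p d t = A.run T p' d' t := by
  unfold OnlineAlgorithm.run history
  congr 1
  refine List.map_congr_left fun s hs => ?_
  obtain ⟨h1, h2⟩ := h s (by simpa [Nat.lt_succ_iff] using hs)
  rw [h1, h2]

/-- The total saving of a schedule with respect to the price `pmax` in the first `t` slots. -/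
def saving (pmax : ℝ) (t : ℕ) (p y : ℕ → ℝ) : ℝ := ∑ s ∈ Finset.range t, (pmax - p s) * y s

/-- The sequence that follows `f` on the first `s` entries and then continues with `g`. -/
def continueWith (s : ℕ) (f g : ℕ → ℝ) (t : ℕ) : ℝ := if t < s then f t else g (t - s)

theorem continueWith_of_lt {s t : ℕ} (f g : ℕ → ℝ) (h : t < s) : continueWith s f g t = f t :=
  if_pos h

theorem continueWith_add (s i : ℕ) (f g : ℕ → ℝ) : continueWith s f g (s + i) = g i := by
  simp [continueWith]

theorem forall_continueWith {s : ℕ} {f g : ℕ → ℝ} {P : ℝ → Prop} (hf : ∀ t, P (f t))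
    (hg : ∀ i, P (g i)) (t : ℕ) : P (continueWith s f g t) := by
  unfold continueWith
  split_ifs
  exacts [hf t, hg _]

theorem level_continueWith {s t : ℕ} (d x d' x' : ℕ → ℝ) (h : t ≤ s) :
    level (continueWith s d d') (continueWith s x x') t = level d x t := by
  simp only [level_eq_sum]
  refine Finset.sum_congr rfl fun r hr => ?_
  have hr : r < s := (Finset.mem_range.1 hr).trans_le h
  rw [continueWith_of_lt _ _ hr, continueWith_of_lt _ _ hr]

theorem level_continueWith_add (s i : ℕ) (d x d' x' : ℕ → ℝ) :
    level (continueWith s d d') (continueWith s x x') (s + i) = level d x s + level d' x' i := by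
  rw [← level_continueWith d x d' x' le_rfl]
  simp only [level_eq_sum, Finset.sum_range_add, continueWith_add]

theorem feasible_continueWith {B : ℝ} {s n : ℕ} {d x d' x' : ℕ → ℝ} (hx : Feasible B s d x)
    (hx0 : level d x s = 0) (hx' : Feasible B n d' x') :
    Feasible B (s + n) (continueWith s d d') (continueWith s x x') := by
  have split : ∀ t < s + n, t < s ∨ ∃ i < n, t = s + i := fun t ht => by
    rcases lt_or_ge t s with h | h
    · exact Or.inl h
    · exact Or.inr ⟨t - s, by omega, by omega⟩
  refine ⟨fun t ht => ?_, fun t ht => ?_, fun t ht => ?_⟩ <;>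
    obtain h | ⟨i, hi, rfl⟩ := split t ht
  · rw [continueWith_of_lt _ _ h]; exact hx.nonneg t h
  · rw [continueWith_add]; exact hx'.nonneg i hi
  · rw [continueWith_of_lt _ _ h, continueWith_of_lt _ _ h, level_continueWith _ _ _ _ h.le]
    exact hx.cover t h
  · rw [continueWith_add, continueWith_add, level_continueWith_add, hx0, zero_add]
    exact hx'.cover i hi
  · rw [level_continueWith _ _ _ _ h]; exact hx.capacity t h
  · rw [add_assoc, level_continueWith_add, hx0, zero_add]
    exact hx'.capacity i hi

theorem level_buy_then_use (B : ℝ) (j i : ℕ) :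
    level (Pi.single (j + 1) B) (Pi.single j B) i = if i = j + 1 then B else 0 := by
  induction i with
  | zero => simp [level]
  | succ i ih =>
    rw [level, ih]
    simp only [Pi.single_apply, Nat.add_right_cancel_iff]
    split_ifs <;> first | omega | ring

theorem feasible_buy_then_use {B : ℝ} (hB : 0 ≤ B) (j T : ℕ) :
    Feasible B T (Pi.single (j + 1) B) (Pi.single j B) := by
  refine ⟨fun t _ => ?_, fun t _ => ?_, fun t _ => ?_⟩
  · rw [Pi.single_apply]; split_ifs <;> simp [hB]
  · rw [level_buy_then_use]
    simp only [Pi.single_apply]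
    split_ifs <;> simp [hB]
  · rw [level_buy_then_use]
    split_ifs <;> simp [hB]

/-- One round of the adversary: continue the instance by `n + 2` slots on which the algorithm falls
behind by the ratio `a`, while some schedule starts and ends the round with empty inventory. -/
theorem adversary_round {pmin pmax B a : ℝ} {n T s : ℕ} (A : OnlineAlgorithm) (hB : 0 ≤ B)
    {u : ℕ → ℝ} (hu : ∀ i ≤ n, u i ∈ Set.Icc pmin pmax) (hle : pmin ≤ pmax)
    (hgrid : ∀ δ : ℕ → ℝ, ∑ i ∈ Finset.range (n + 1), δ i ≤ B →
      ∃ j ≤ n, ∑ i ∈ Finset.range (j + 1), (pmax - u i) * δ i ≤ B * (pmax - a * u j))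
    (hA : ∀ p d : ℕ → ℝ, IsInstance pmin pmax T p d → Feasible B T d (A.run T p d))
    (hT : s + (n + 2) ≤ T) {p d x : ℕ → ℝ} (hp : ∀ t, p t ∈ Set.Icc pmin pmax)
    (hd : ∀ t, 0 ≤ d t) (hx : Feasible B s d x) (hx0 : level d x s = 0) :
    ∃ p' d' x' : ℕ → ℝ, (∀ t, p' t ∈ Set.Icc pmin pmax) ∧ (∀ t, 0 ≤ d' t) ∧
      Feasible B (s + (n + 2)) d' x' ∧ level d' x' (s + (n + 2)) = 0 ∧
      cost s p x + pmin * B ≤ cost (s + (n + 2)) p' x' ∧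
      a * (cost (s + (n + 2)) p' x' - cost s p x) ≤
        (pmax * ∑ t ∈ Finset.range (s + (n + 2)), d' t -
          saving pmax (s + (n + 2)) p' (A.run T p' d')) -
        (pmax * ∑ t ∈ Finset.range s, d t - saving pmax s p (A.run T p d)) := by
  -- A trial continuation without demand reveals the purchases along the whole price grid. They
  -- total at most `B`, as the level stays in `[0, B]`, so `hgrid` yields a stop `j`.
  set p₁ := continueWith s p fun i => if i ≤ n then u i else pmax with hp₁
  set d₁ := continueWith s d fun _ => 0 with hd₁
  have hp₁mem : ∀ t, p₁ t ∈ Set.Icc pmin pmax := forall_continueWith hp fun i => by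
    split_ifs with h
    exacts [hu i h, ⟨hle, le_rfl⟩]
  have hd₁mem : ∀ t, 0 ≤ d₁ t := forall_continueWith hd fun _ => le_rfl
  have hF := hA p₁ d₁ fun t _ => ⟨hp₁mem t, hd₁mem t⟩
  obtain ⟨j, hj, hjs⟩ := hgrid (fun i => A.run T p₁ d₁ (s + i)) (by
    have h1 := (hF.level_mem hB (t := s) (by omega)).1
    have h2 := (hF.level_mem hB (t := s + (n + 1)) (by omega)).2
    rw [level_eq_sum, Finset.sum_range_add, ← level_eq_sum] at h2
    simp only [hd₁, continueWith_add, sub_zero] at h2 h1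
    linarith)
  -- The actual continuation agrees with the trial through slot `s + j`, hence so do the purchases.
  -- Later slots have price `pmax` and contribute no saving.
  set p₂ := continueWith s p fun i => if i ≤ j then u i else pmax with hp₂
  set d₂ := continueWith s d (Pi.single (j + 1) B) with hd₂
  have hrun : ∀ i ≤ j, A.run T p₂ d₂ (s + i) = A.run T p₁ d₁ (s + i) := fun i hi => by
    refine run_congr A T fun t ht => ?_
    rcases lt_or_ge t s with h | h
    · simp only [hp₁, hp₂, hd₁, hd₂, continueWith_of_lt _ _ h, and_self]
    · obtain ⟨k, rfl⟩ := Nat.exists_eq_add_of_le h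
      simp only [hp₁, hp₂, hd₁, hd₂, continueWith_add]
      rw [if_pos (by omega), if_pos (by omega), Pi.single_eq_of_ne (by omega)]
      exact ⟨rfl, rfl⟩
  have hrun0 : ∀ t < s, A.run T p₂ d₂ t = A.run T p d t := fun t ht =>
    run_congr A T fun r hr => ⟨continueWith_of_lt _ _ (by omega),
      continueWith_of_lt _ _ (by omega)⟩
  have hcost : cost (s + (n + 2)) p₂ (continueWith s x (Pi.single j B)) =
      cost s p x + u j * B := by
    unfold cost
    rw [Finset.sum_range_add]
    congr 1
    · refine Finset.sum_congr rfl fun t ht => ?_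
      have ht := Finset.mem_range.1 ht
      rw [hp₂, continueWith_of_lt _ _ ht, continueWith_of_lt _ _ ht]
    · simp only [hp₂, continueWith_add]
      rw [Finset.sum_eq_single j]
      · simp
      · intro i _ hi
        simp [Pi.single_eq_of_ne hi]
      · intro hi
        exact absurd (Finset.mem_range.2 (by omega)) hi
  have hdem : ∑ t ∈ Finset.range (s + (n + 2)), d₂ t = ∑ t ∈ Finset.range s, d t + B := by
    rw [Finset.sum_range_add]
    congr 1
    · exact Finset.sum_congr rfl fun t ht => continueWith_of_lt _ _ (Finset.mem_range.1 ht)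
    · simp only [hd₂, continueWith_add]
      rw [Finset.sum_eq_single_of_mem (j + 1) (Finset.mem_range.2 (by omega))
        fun i _ hi => Pi.single_eq_of_ne hi _, Pi.single_eq_same]
  have hsav : saving pmax (s + (n + 2)) p₂ (A.run T p₂ d₂) = saving pmax s p (A.run T p d) +
      ∑ i ∈ Finset.range (j + 1), (pmax - u i) * A.run T p₁ d₁ (s + i) := by
    unfold saving
    rw [Finset.sum_range_add]
    congr 1
    · refine Finset.sum_congr rfl fun t ht => ?_
      have ht := Finset.mem_range.1 ht
      rw [hrun0 t ht, hp₂, continueWith_of_lt _ _ ht]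
    · rw [← Finset.sum_subset (Finset.range_mono (show j + 1 ≤ n + 2 by omega))]
      · refine Finset.sum_congr rfl fun i hi => ?_
        have hi : i ≤ j := Nat.lt_succ_iff.1 (Finset.mem_range.1 hi)
        rw [hrun i hi, hp₂, continueWith_add, if_pos hi]
      · intro i _ hi
        rw [hp₂, continueWith_add, if_neg (by simpa [Nat.lt_succ_iff] using hi), sub_self,
          zero_mul]
  refine ⟨p₂, d₂, continueWith s x (Pi.single j B), ?_, ?_,
    feasible_continueWith hx hx0 (feasible_buy_then_use hB j _), ?_, ?_, ?_⟩
  · refine forall_continueWith hp fun i => ?_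
    split_ifs with h
    exacts [hu i (h.trans hj), ⟨hle, le_rfl⟩]
  · refine forall_continueWith hd fun i => ?_
    rw [Pi.single_apply]
    split_ifs <;> simp [hB]
  · rw [hd₂, level_continueWith_add, hx0, level_buy_then_use, if_neg (by omega), add_zero]
  · rw [hcost]
    gcongr
    exact (hu j hj).1
  · rw [hcost, hdem, hsav]
    linarith

/-- The adversary repeats its rounds. -/
theorem adversary_rounds {pmin pmax B a : ℝ} {n T : ℕ} (A : OnlineAlgorithm) (hB : 0 ≤ B)
    {u : ℕ → ℝ} (hu : ∀ i ≤ n, u i ∈ Set.Icc pmin pmax) (hle : pmin ≤ pmax)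
    (hgrid : ∀ δ : ℕ → ℝ, ∑ i ∈ Finset.range (n + 1), δ i ≤ B →
      ∃ j ≤ n, ∑ i ∈ Finset.range (j + 1), (pmax - u i) * δ i ≤ B * (pmax - a * u j))
    (hA : ∀ p d : ℕ → ℝ, IsInstance pmin pmax T p d → Feasible B T d (A.run T p d))
    (k : ℕ) (hT : k * (n + 2) ≤ T) :
    ∃ p d x : ℕ → ℝ, (∀ t, p t ∈ Set.Icc pmin pmax) ∧ (∀ t, 0 ≤ d t) ∧
      Feasible B (k * (n + 2)) d x ∧ level d x (k * (n + 2)) = 0 ∧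
      k * (pmin * B) ≤ cost (k * (n + 2)) p x ∧
      a * cost (k * (n + 2)) p x ≤ pmax * ∑ t ∈ Finset.range (k * (n + 2)), d t -
        saving pmax (k * (n + 2)) p (A.run T p d) := by
  induction k with
  | zero =>
    refine ⟨fun _ => pmax, fun _ => 0, fun _ => 0, fun _ => ⟨hle, le_rfl⟩, fun _ => le_rfl, ?_⟩
    rw [zero_mul]
    refine ⟨⟨fun t ht => absurd ht t.not_lt_zero, fun t ht => absurd ht t.not_lt_zero,
      fun t ht => absurd ht t.not_lt_zero⟩, rfl, ?_, ?_⟩ <;> simp [cost, saving]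
  | succ k ih =>
    rw [add_one_mul] at hT ⊢
    obtain ⟨p, d, x, hp, hd, hx, hx0, h1, h2⟩ := ih (by omega)
    obtain ⟨p', d', x', hp', hd', hx', hx0', h1', h2'⟩ :=
      adversary_round A hB hu hle hgrid hA hT hp hd hx hx0
    refine ⟨p', d', x', hp', hd', hx', hx0', ?_, ?_⟩
    · push_cast
      linarith
    · linarith

/-- A round of the adversary forces every ratio below `α`, and many rounds outweigh the additive
constant. -/
theorem le_of_competitive {pmin pmax B : ℝ} (hpmin : 0 < pmin) (hp : pmin < pmax) (hB : 0 < B)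
    {α : ℝ} (hα : 1 < α) (hs : pmax * ((1 - 1 / α) * Real.exp (1 / α)) = pmax - pmin)
    {A : OnlineAlgorithm} {c : ℝ} (hA : Competitive pmin pmax B A c) : α ≤ c := by
  by_contra! hc
  obtain ⟨K, -, hK⟩ := hA
  have hpmax : 0 < pmax := hpmin.trans hp
  -- The maximum with `0` gives `a > 0` and a nonnegative multiplier for the bound on the optimal
  -- cost.
  obtain ⟨a, hca, haα⟩ := exists_between (max_lt hc (show (0 : ℝ) < α by linarith))
  have ha : 0 < a := (le_max_right _ _).trans_lt hca
  obtain ⟨n, hn, hgt⟩ := exists_grid hα ha haα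
  have h1α : 0 < 1 - 1 / α := by
    rw [sub_pos, div_lt_one (by linarith)]
    exact hα
  have hn' : (0 : ℝ) < n := by exact_mod_cast hn
  set r := Real.exp (1 / (α * n)) with hr
  have hr1 : 1 < r := Real.one_lt_exp_iff.2 (by positivity)
  set q : ℕ → ℝ := fun i => pmax * (1 - 1 / α) * r ^ i with hq
  have hq0 : ∀ i, 0 < q i := fun i => by positivity
  have hqn : q n = pmax - pmin := by
    rw [← hs, ← mul_assoc]
    simp only [hq, hr]
    rw [← Real.exp_nat_mul]
    congr 2
    field_simp
  have hu : ∀ i ≤ n, pmax - q i ∈ Set.Icc pmin pmax := fun i hi => by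
    have h1 : q i ≤ q n := mul_le_mul_of_nonneg_left (pow_le_pow_right₀ hr1.le hi) (by positivity)
    constructor <;> linarith [hq0 i]
  have hgrid : ∀ δ : ℕ → ℝ, ∑ i ∈ Finset.range (n + 1), δ i ≤ B → ∃ j ≤ n,
      ∑ i ∈ Finset.range (j + 1), (pmax - (pmax - q i)) * δ i ≤
        B * (pmax - a * (pmax - q j)) := by
    intro δ hδ
    by_contra! h
    simp only [sub_sub_cancel] at h
    have h1 := sum_ge_of_savings hr1 hq0 (fun i => by rw [hq]; ring) fun j hj => (h j hj).le
    have h2 : (pmax - a * (pmax - q 0)) / q 0 = (α - a) / (α - 1) := by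
      have : 0 < α - 1 := by linarith
      rw [div_eq_div_iff (hq0 0).ne' this.ne', hq]
      field_simp
      ring
    rw [h2] at h1
    nlinarith
  -- Each round costs the comparison schedule at least `pmin * B`, so `N` rounds create a gap above
  -- `K`.
  obtain ⟨N, hN⟩ := exists_nat_gt (K / ((a - max c 0) * (pmin * B)))
  rw [div_lt_iff₀ (mul_pos (sub_pos.2 hca) (mul_pos hpmin hB))] at hN
  obtain ⟨p, d, x, hpI, hd, hx, -, h1, h2⟩ := adversary_rounds A hB.le hu hp.le hgrid
    (fun p d h => (hK (N * (n + 2)) p d h).1) N le_rfl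
  have hI : IsInstance pmin pmax (N * (n + 2)) p d := fun t _ => ⟨hpI t, hd t⟩
  obtain ⟨hF, hle⟩ := hK _ p d hI
  -- The final inventory is nonnegative, so total purchases cover total demand.
  have h3 : pmax * ∑ t ∈ Finset.range (N * (n + 2)), d t -
      saving pmax (N * (n + 2)) p (A.run (N * (n + 2)) p d) ≤
      cost (N * (n + 2)) p (A.run (N * (n + 2)) p d) := by
    have h4 := mul_nonneg hpmax.le (hF.level_mem hB.le le_rfl).1
    rw [level_eq_sum, Finset.sum_sub_distrib, mul_sub] at h4
    have h5 : saving pmax (N * (n + 2)) p (A.run (N * (n + 2)) p d) =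
        pmax * ∑ t ∈ Finset.range (N * (n + 2)), A.run (N * (n + 2)) p d t -
          cost (N * (n + 2)) p (A.run (N * (n + 2)) p d) := by
      simp only [saving, cost, Finset.mul_sum, ← Finset.sum_sub_distrib, sub_mul]
    linarith
  have h6 := optCost_nonneg (B := B) hpmin.le hI
  have h7 := optCost_le hpmin.le hI hx
  have h8 := mul_le_mul_of_nonneg_right (le_max_left c 0) h6
  have h9 := mul_le_mul_of_nonneg_left h7 (le_max_right c 0)
  have h10 := mul_le_mul_of_nonneg_left h1 (sub_pos.2 hca).le
  linarith

end OLIM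

end

theorem theorem1p1 (pmin pmax B : ℝ) (hpmin : 0 < pmin) (hp : pmin < pmax) (hB : 0 < B) :
    OLIM.CompetitiveWith pmin pmax B
        (OLIM.batMan pmax (OLIM.alpha (pmax / pmin)) B)
        (OLIM.alpha (pmax / pmin)) (B * pmax) ∧
      ∀ (A : OLIM.OnlineAlgorithm) (c : ℝ), OLIM.Competitive pmin pmax B A c →
        OLIM.alpha (pmax / pmin) ≤ c := by
  have hpmax : 0 < pmax := hpmin.trans hp
  obtain ⟨hα, hspec⟩ := OLIM.alpha_spec ((one_lt_div hpmin).2 hp)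
  set α := OLIM.alpha (pmax / pmin)
  have hs : pmax * ((1 - 1 / α) * Real.exp (1 / α)) = pmax - pmin := by
    rw [hspec]
    field_simp
  exact ⟨OLIM.batMan_competitiveWith hpmin hα hpmax hB.le (OLIM.le_pmax_div hα hpmax hs) hs,
    fun A c hA => OLIM.le_of_competitive hpmin hp hB hα hs hA⟩
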